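/- Let $k\ge 3$ and let $w_1,w_2,\ldots$ be independent random variables, each uniformly distributed over the alphabet $[k]=\{1,\ldots,k\}$, all defined on one probability space; put $W_n=w_1w_2\cdots w_n$. A word $\pi_1\cdots\pi_n$ over $[k]$ is called a staircase if $|\pi_{i+1}-\pi_i|\le 1$ for all $1\le i\le n-1$. Let $S_k(n)$ be the staircase separation number of $W_n$. That is, $S_k(n)=0$ if $W_n$ is a staircase, and otherwise $S_k(n)=d\ge 1$, where $W_n=\pi^{(1)}\pi^{(2)}\cdots\pi^{(d+1)}$ is the decomposition of $W_n$ into nonempty consecutive maximal staircase subwords (each $\pi^{(i)}$ is a staircase, and $\pi^{(i)}$ followed by the first letter of $\pi^{(i+1)}$ is not a staircase). Let $J_k(n)$ be the length of the longest left-most staircase subsequence of $W_n$. That is, let $i_1=1$ and, recursively, $i_{j+1}=\inf\{m : i_j<m\le n,\ |w_m-w_{i_j}|\le 1\}$ with $\inf\emptyset=+\infty$ (and $i_{j+1}=+\infty$ if $i_j=+\infty$); then $J_k(n)=\max\{r\ge 1: i_r<\infty\}$. Put $\psi_k=\frac{(k-2)(k-1)}{k^2}$ and $\varphi_k=\frac{3k-2}{k^2}$.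 There are constants $\sigma_k,\nu_k\in(0,\infty)$, depending only on $k$, such that the following hold: (i) $\lim_{n\to\infty} S_k(n)/n=\psi_k$ with probability one. (ii) $\dfrac{S_k(n)-\psi_k n}{\sigma_k\sqrt n}$ converges in distribution to the standard normal law $\mathcal N(0,1)$ as $n\to\infty$. (iii) $\lim_{n\to\infty} J_k(n)/n=\varphi_k$ with probability one. (iv) $\dfrac{J_k(n)-\varphi_k n}{\nu_k\sqrt n}$ converges in distribution to $\mathcal N(0,1)$ as $n\to\infty$. -/

import Mathlib

open MeasureTheory ProbabilityTheory Filter Topology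

namespace StaircaseWords

/-- Two letters of the linearly ordered alphabet `[k]` are neighbors if they differ by at most one.
The alphabet is `Fin k`, the element `a : Fin k` standing for the letter `a + 1`. -/
def Neighbor {k : ℕ} (a b : Fin k) : Prop :=
  |((a : ℕ) : ℤ) - ((b : ℕ) : ℤ)| ≤ 1

/-- A word is a staircase if any two adjacent letters of it are neighbors. -/
def IsStaircase {k : ℕ} (π : List (Fin k)) : Prop :=
  List.IsChain Neighbor π

/-- `L` is a representation of `π` as a concatenation of consecutive maximal staircase subwords:
every block is a nonempty staircase, and a block followed by the first letter of the next block is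
not a staircase. -/
structure IsMaximalDecomposition {k : ℕ} (π : List (Fin k)) (L : List (List (Fin k))) : Prop where
  flatten_eq : L.flatten = π
  ne_nil : ∀ b ∈ L, b ≠ []
  staircase : ∀ b ∈ L, IsStaircase b
  maximal : L.IsChain (fun b c => ∀ x ∈ c.head?, ¬ IsStaircase (b ++ [x]))

/-- `π` is `d`-separated: for `d = 0` this means that it is a staircase, for `d ≥ 1` it means that
`π` is the concatenation of `d + 1` consecutive maximal staircase subwords. -/
def IsSeparated {k : ℕ} (π : List (Fin k)) (d : ℕ) : Prop :=
  (d = 0 ∧ IsStaircase π) ∨ (1 ≤ d ∧ ∃ L, IsMaximalDecomposition π L ∧ L.length = d + 1)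

/-- The staircase separation number of `π`: the number `d` for which `π` is `d`-separated
(there is exactly one, see `isSeparated_iff`). -/
noncomputable def separationNumber {k : ℕ} (π : List (Fin k)) : ℕ :=
  sInf {d | IsSeparated π d}

/-- The positions of the left-most staircase subsequence of `π`, numbered from zero: the first one
is the first position of the word (`⊤` if the word is empty), and each next one is the least later
position that holds a neighbor of the letter at the current one (`⊤` if there is none). -/
noncomputable def leftPos {k : ℕ} (π : List (Fin k)) : ℕ → ℕ∞
  | 0 => sInf {m : ℕ∞ | ∃ j : Fin π.length, m = (j : ℕ)}
  | l + 1 => sInf {m : ℕ∞ | ∃ i j : Fin π.length, leftPos π l = (i : ℕ) ∧ m = (j : ℕ) ∧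
      i < j ∧ Neighbor (π.get i) (π.get j)}

/-- The length of the longest left-most staircase subsequence: the largest `r` such that the `r`-th
position (which is `leftPos π (r - 1)`) is finite; it is `0` for the empty word. -/
noncomputable def leftLength {k : ℕ} (π : List (Fin k)) : ℕ :=
  sSup {r : ℕ | ∃ l, r = l + 1 ∧ leftPos π l < ⊤}

/-- `w` is a sequence of independent letters, each uniformly distributed over the alphabet. -/
structure IsUniformLetters {k : ℕ} {Ω : Type*} [MeasurableSpace Ω] (P : Measure Ω)
    (w : ℕ → Ω → Fin k) : Prop where
  measurable : ∀ i, Measurable (w i)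
  indep : iIndepFun w P
  uniform : ∀ i a, P {ω | w i ω = a} = (k : ENNReal)⁻¹

/-- The random word formed by the first `n` letters of the sequence `w`. -/
def randomWord {k : ℕ} {Ω : Type*} (w : ℕ → Ω → Fin k) (n : ℕ) (ω : Ω) : List (Fin k) :=
  List.ofFn (fun i : Fin n => w i ω)

/-- The staircase separation number of the random word of length `n`. -/
noncomputable def sepCount {k : ℕ} {Ω : Type*} (w : ℕ → Ω → Fin k) (n : ℕ) (ω : Ω) : ℕ :=
  separationNumber (randomWord w n ω)

/-- The length of the longest left-most staircase subsequence of the random word of length `n`. -/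
noncomputable def leftCount {k : ℕ} {Ω : Type*} (w : ℕ → Ω → Fin k) (n : ℕ) (ω : Ω) : ℕ :=
  leftLength (randomWord w n ω)

/-! ### The two word statistics are well defined -/

instance {k : ℕ} (a b : Fin k) : Decidable (Neighbor a b) :=
  inferInstanceAs (Decidable (_ ≤ _))

theorem isMaximalDecomposition_iff {k : ℕ} (π : List (Fin k)) (L : List (List (Fin k))) :
    IsMaximalDecomposition π L ↔ π.splitBy (fun a b => decide (Neighbor a b)) = L := by
  have key : (∀ b ∈ L, b ≠ []) → (∀ b ∈ L, IsStaircase b) →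
      (L.IsChain (fun b c => ∀ x ∈ c.head?, ¬ IsStaircase (b ++ [x])) ↔
        L.IsChain fun a b => ∃ ha hb,
          decide (Neighbor (a.getLast ha) (b.head hb)) = false) := by
    intro hn hs
    rw [List.isChain_iff_getElem, List.isChain_iff_getElem]
    refine forall₂_congr fun i hi => ?_
    have h1 := hn _ (List.getElem_mem (l := L) (n := i) (by omega))
    have h2 := hn _ (List.getElem_mem (l := L) (n := i + 1) (by omega))
    have h3 := hs _ (List.getElem_mem (l := L) (n := i) (by omega))
    generalize L[i] = b at *
    generalize L[i + 1] = c at *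
    unfold IsStaircase at h3 ⊢
    simp [List.head?_eq_some_head h2, List.isChain_append, h1, h2, h3,
      List.getLast?_eq_some_getLast h1]
  rw [List.splitBy_eq_iff]
  constructor
  · rintro ⟨h1, h2, h3, h4⟩
    refine ⟨h1.symm, fun h => h2 _ h rfl, ?_, (key h2 h3).1 h4⟩
    simpa [IsStaircase] using h3
  · rintro ⟨h1, h2, h3, h4⟩
    have h2' : ∀ b ∈ L, b ≠ [] := fun b hb h => h2 (h ▸ hb)
    have h3' : ∀ b ∈ L, IsStaircase b := by simpa [IsStaircase] using h3
    exact ⟨h1.symm, h2', h3', (key h2' h3').2 h4⟩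

theorem isSeparated_iff_splitBy {k : ℕ} (π : List (Fin k)) (d : ℕ) :
    IsSeparated π d ↔ d = (π.splitBy (fun a b => decide (Neighbor a b))).length - 1 := by
  have hst : IsStaircase π ↔ (π.splitBy (fun a b => decide (Neighbor a b))).length ≤ 1 := by
    rcases eq_or_ne π [] with rfl | hπ
    · simp [IsStaircase]
    constructor
    · intro h
      have : IsMaximalDecomposition π [π] :=
        ⟨by simp, by simpa using hπ, by simpa using h, by simp⟩
      rw [(isMaximalDecomposition_iff _ _).1 this]
      simp
    · intro h
      have hd := (isMaximalDecomposition_iff π _).2 rfl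
      generalize π.splitBy (fun a b => decide (Neighbor a b)) = L at *
      match L, h with
      | [], _ => exact absurd hd.flatten_eq.symm (by simpa using hπ)
      | [b], _ =>
        have := hd.flatten_eq
        have h2 := hd.staircase b (by simp)
        simp at this
        exact this ▸ h2
  unfold IsSeparated
  rw [hst]
  simp only [isMaximalDecomposition_iff]
  constructor
  · rintro (⟨h1, h2⟩ | ⟨h1, L, rfl, h3⟩) <;> omega
  · intro h
    by_cases h0 : d = 0
    · left; omega
    · right; exact ⟨by omega, _, rfl, by omega⟩

theorem separationNumber_eq {k : ℕ} (π : List (Fin k)) :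
    separationNumber π = (π.splitBy (fun a b => decide (Neighbor a b))).length - 1 := by
  simp [separationNumber, isSeparated_iff_splitBy]

theorem isSeparated_iff {k : ℕ} (π : List (Fin k)) (d : ℕ) :
    IsSeparated π d ↔ d = separationNumber π := by
  rw [isSeparated_iff_splitBy, separationNumber_eq]

theorem leftPos_lt_top {k : ℕ} (π : List (Fin k)) (l : ℕ) (h : leftPos π l < ⊤) :
    ∃ j : Fin π.length, leftPos π l = (j : ℕ) ∧ l ≤ j := by
  induction l with
  | zero =>
    have hne : {m : ℕ∞ | ∃ j : Fin π.length, m = (j : ℕ)}.Nonempty := by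
      by_contra hc
      rw [Set.not_nonempty_iff_eq_empty] at hc
      simp [leftPos, hc] at h
    obtain ⟨j, hj⟩ := csInf_mem hne
    exact ⟨j, hj, Nat.zero_le _⟩
  | succ l ih =>
    have hne : {m : ℕ∞ | ∃ i j : Fin π.length, leftPos π l = (i : ℕ) ∧ m = (j : ℕ) ∧
        i < j ∧ Neighbor (π.get i) (π.get j)}.Nonempty := by
      by_contra hc
      rw [Set.not_nonempty_iff_eq_empty] at hc
      rw [leftPos, hc] at h
      simp at h
    obtain ⟨i, j, hi, hj, hij, -⟩ := csInf_mem hne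
    obtain ⟨i', hi', hl⟩ := ih (by rw [hi]; exact WithTop.coe_lt_top _)
    have : (i : ℕ) = i' := by rw [hi] at hi'; exact_mod_cast hi'
    have : (i : ℕ) < j := hij
    exact ⟨j, hj, by omega⟩

theorem bddAbove_leftPos {k : ℕ} (π : List (Fin k)) :
    BddAbove {r : ℕ | ∃ l, r = l + 1 ∧ leftPos π l < ⊤} := by
  refine ⟨π.length, ?_⟩
  rintro r ⟨l, rfl, h⟩
  obtain ⟨j, -, hl⟩ := leftPos_lt_top π l h
  omega

end StaircaseWords

open StaircaseWords

/-! Both statistics are, up to an error of at most 1, additive functionals `∑ g (X_m, w_{m+1})` of a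
chain `X_{m+1} = F (X_m, w_{m+1})` on the alphabet. For the separation number `X_m` is the current
letter and `g` marks non-neighbors; for the left-most subsequence `X_m` is the last accepted letter
and `g` marks acceptance. Each chain preserves the uniform law, so the limiting mean `φ` is the
average of `g` over all pairs of letters.

The Poisson equation gives `h` such that `d x a = g x a - φ + h (F x a) - h x` averages to zero over
the new letter `a`. Hence the functional minus `φ n` is a bounded-increment martingale `M_n` plus a
bounded error, and it suffices to treat `M_n`. Strong law: `E M_n ^ 4 = O(n ^ 2)`, so the fourth
moments of `M_n / n` are summable. CLT: a second Poisson equation gives a corrector `q` for the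
conditional variance. With weight `exp (-q(X_n) s² / 2)`, the expectation of `exp (i s M_n)` is
multiplied at each step by `exp (-σ² s² / 2)` up to `O(s³)`. For `s = t / (σ √n)` the `n` errors sum
to `O(n^{-1/2})`. The variance is positive because some transition is a loop, where `h` cancels,
with `g ≠ φ`. -/

namespace StaircaseWords

/-! ### Letter-driven chains -/

/-- The chain started at the first letter of `w` and driven by the remaining letters through the
update rule `F`. -/
def chain {k : ℕ} (F : Fin k → Fin k → Fin k) (w : ℕ → Fin k) : ℕ → Fin k
  | 0 => w 0
  | n + 1 => F (chain F w n) (w (n + 1))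

/-- The sum of `g` over the first `n` transitions of the chain. -/
def chainSum {k : ℕ} (F : Fin k → Fin k → Fin k) (g : Fin k → Fin k → ℝ) (w : ℕ → Fin k)
    (n : ℕ) : ℝ :=
  ∑ m ∈ Finset.range n, g (chain F w m) (w (m + 1))

/-- The update rule of the left-most staircase subsequence: only neighbors are accepted. -/
def accept {k : ℕ} (x a : Fin k) : Fin k :=
  if Neighbor x a then a else x

/-! ### The separation number as a chain sum -/

/-- Each failing transition closes one block, and the `+ 1` is the block still open at the end. Word
and accumulators are general because the recursion shifts the word and changes both accumulators. -/
theorem length_splitBy_loop_ofFn {k : ℕ} (r : Fin k → Fin k → Bool) (n : ℕ) (w : ℕ → Fin k)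
    (g : List (Fin k)) (acc : List (List (Fin k))) :
    (List.splitBy.loop r (List.ofFn fun i : Fin n => w (i + 1)) (w 0) g acc).length =
      acc.length + 1 + ∑ m ∈ Finset.range n, if r (w m) (w (m + 1)) then 0 else 1 := by
  induction n generalizing w g acc with
  | zero => simp [List.splitBy.loop]
  | succ n ih =>
    rw [List.ofFn_succ, List.splitBy.loop, Finset.sum_range_succ']
    have ih' := ih (fun i => w (i + 1))
    simp only [Fin.val_succ, Fin.val_zero, zero_add] at ih' ⊢
    cases h : r (w 0) (w 1)
    · simp only [ih']
      simp
      omega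
    · simp only [ih']
      simp

theorem separationNumber_ofFn {k : ℕ} (w : ℕ → Fin k) (n : ℕ) :
    (separationNumber (List.ofFn fun i : Fin (n + 1) => w i) : ℝ) =
      chainSum (fun _ a => a) (fun x a => if Neighbor x a then 0 else 1) w n := by
  have hc : ∀ m, chain (fun _ a => a) w m = w m := by
    intro m; cases m <;> rfl
  rw [separationNumber_eq, List.ofFn_succ]
  simp only [List.splitBy, Fin.val_succ, Fin.val_zero, length_splitBy_loop_ofFn, chainSum, hc]
  simp

/-! ### The left-most staircase subsequence as a chain sum -/

/-- The last position up to `m` that belongs to the left-most staircase subsequence. -/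
def lastPos {k : ℕ} (w : ℕ → Fin k) : ℕ → ℕ
  | 0 => 0
  | m + 1 => if Neighbor (w (lastPos w m)) (w (m + 1)) then m + 1 else lastPos w m

/-- The number of transitions of the left-most staircase subsequence up to position `m`. -/
def acceptCount {k : ℕ} (w : ℕ → Fin k) (n : ℕ) : ℕ :=
  ∑ m ∈ Finset.range n, if Neighbor (w (lastPos w m)) (w (m + 1)) then 1 else 0

theorem chain_accept {k : ℕ} (w : ℕ → Fin k) (m : ℕ) : chain accept w m = w (lastPos w m) := by
  induction m with
  | zero => rfl
  | succ m ih =>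
    rw [chain, ih, accept, lastPos]
    split_ifs <;> rfl

theorem lastPos_le {k : ℕ} (w : ℕ → Fin k) (m : ℕ) : lastPos w m ≤ m := by
  induction m with
  | zero => rfl
  | succ m ih => rw [lastPos]; split_ifs <;> omega

theorem not_neighbor_of_lastPos_lt {k : ℕ} (w : ℕ → Fin k) (m j : ℕ) (h : lastPos w m < j)
    (hj : j ≤ m) : ¬ Neighbor (w (lastPos w m)) (w j) := by
  induction m with
  | zero => omega
  | succ m ih =>
    rw [lastPos] at h ⊢
    split_ifs at h ⊢ with hn
    · omega
    · rcases Nat.lt_or_ge m j with hmj | hmj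
      · obtain rfl : j = m + 1 := by omega
        exact hn
      · exact ih h hmj

/-- Identifies the recursive infima with a greedy scan: every letter read after the last accepted
position was rejected against that same letter, so the next neighbor found is the least one. -/
theorem leftPos_ofFn {k : ℕ} (w : ℕ → Fin k) (n m : ℕ) (hm : m ≤ n) :
    leftPos (List.ofFn fun i : Fin (n + 1) => w i) (acceptCount w m) = (lastPos w m : ℕ) := by
  induction m with
  | zero =>
    simp only [acceptCount, Finset.range_zero, Finset.sum_empty, leftPos, lastPos]
    refine le_antisymm (csInf_le' ⟨⟨0, by simp⟩, by simp⟩) (by simp)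
  | succ m ih =>
    have ih := ih (by omega)
    have hle := lastPos_le w m
    rw [acceptCount, Finset.sum_range_succ, lastPos]
    split_ifs with hn
    · rw [leftPos]
      change sInf {x : ℕ∞ | ∃ i j : Fin _, leftPos _ (acceptCount w m) = _ ∧ _} = _
      rw [ih]
      refine le_antisymm (csInf_le' ⟨⟨lastPos w m, by simp; omega⟩, ⟨m + 1, by simp; omega⟩,
        rfl, rfl, by simp; omega, by simpa only [List.get_ofFn, Fin.val_cast] using hn⟩) ?_
      refine le_csInf ⟨_, ⟨lastPos w m, by simp; omega⟩, ⟨m + 1, by simp; omega⟩,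
        rfl, rfl, by simp; omega, by simpa only [List.get_ofFn, Fin.val_cast] using hn⟩ ?_
      rintro x ⟨i, j, hi, rfl, hij, hN⟩
      have hi' : lastPos w m = i := by exact_mod_cast hi
      have hij' : (i : ℕ) < j := hij
      simp only [List.get_ofFn, Fin.val_cast] at hN
      by_contra hlt
      have hlt' : (j : ℕ) < m + 1 := by
        have := not_le.1 hlt
        exact_mod_cast this
      exact not_neighbor_of_lastPos_lt w m j (by omega) (by omega) (by rw [hi']; exact hN)
    · exact ih

theorem leftPos_ofFn_of_acceptCount_lt {k : ℕ} (w : ℕ → Fin k) (n l : ℕ)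
    (hl : acceptCount w n < l) :
    leftPos (List.ofFn fun i : Fin (n + 1) => w i) l = ⊤ := by
  induction l, hl using Nat.le_induction with
  | base =>
    have h := leftPos_ofFn w n n le_rfl
    rw [Nat.succ_eq_add_one, leftPos, h]
    refine sInf_eq_top.2 ?_
    rintro x ⟨i, j, hi, rfl, hij, hN⟩
    have hi' : lastPos w n = i := by exact_mod_cast hi
    have hij' : (i : ℕ) < j := hij
    have hj := j.2
    simp only [List.length_ofFn] at hj
    simp only [List.get_ofFn, Fin.val_cast] at hN
    exact (not_neighbor_of_lastPos_lt w n j (by omega) (by omega) (by rw [hi']; exact hN)).elim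
  | succ l _ ih =>
    rw [leftPos, ih]
    refine sInf_eq_top.2 ?_
    rintro x ⟨i, j, hi, -⟩
    exact absurd hi (by simp)

theorem leftLength_ofFn {k : ℕ} (w : ℕ → Fin k) (n : ℕ) :
    (leftLength (List.ofFn fun i : Fin (n + 1) => w i) : ℝ) =
      1 + chainSum accept (fun x a => if Neighbor x a then 1 else 0) w n := by
  have h : leftLength (List.ofFn fun i : Fin (n + 1) => w i) = acceptCount w n + 1 := by
    refine IsGreatest.csSup_eq ⟨⟨acceptCount w n, rfl, ?_⟩, ?_⟩
    · rw [leftPos_ofFn w n n le_rfl]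
      exact WithTop.coe_lt_top _
    · rintro r ⟨l, rfl, hl⟩
      by_contra hlt
      rw [leftPos_ofFn_of_acceptCount_lt w n l (by omega)] at hl
      exact lt_irrefl _ hl
  rw [h, chainSum, acceptCount]
  simp only [chain_accept]
  push_cast
  ring

/-! ### Solvability of the Poisson equation -/

/-- The Poisson equation of the chain with update rule `F` and uniform letters is solvable for
every right-hand side of mean zero. -/
def PoissonSolvable {k : ℕ} (F : Fin k → Fin k → Fin k) : Prop :=
  ∀ r : Fin k → ℝ, ∑ x, r x = 0 →
    ∃ q : Fin k → ℝ, ∀ x, ∑ a, (q x - q (F x a)) = k * r x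

theorem poissonSolvable_last {k : ℕ} : PoissonSolvable (fun _ a : Fin k => a) := by
  intro r hr
  refine ⟨r, fun x => ?_⟩
  simp [Finset.sum_sub_distrib, hr]

theorem neighbor_iff {k : ℕ} (x a : Fin k) :
    Neighbor x a ↔ (a : ℕ) = x ∨ (a : ℕ) = x + 1 ∨ (a : ℕ) + 1 = x := by
  unfold Neighbor
  rw [abs_le]
  omega

/-- The function lives on `ℕ` so that `x ± 1` needs no bounds; the two guards remove the missing
neighbors at the ends of the alphabet. -/
theorem sum_neighbor {k : ℕ} (x : Fin k) (f : ℕ → ℝ) :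
    ∑ a : Fin k, (if Neighbor x a then f a else 0) =
      f x + (if (x : ℕ) + 1 < k then f (x + 1) else 0) +
        (if (x : ℕ) = 0 then 0 else f (x - 1)) := by
  have hx := x.2
  have hsplit : ∀ a : Fin k, (if Neighbor x a then f a else 0) =
      (if (x : ℕ) = (a : ℕ) then f a else 0) + (if (x : ℕ) + 1 = (a : ℕ) then f a else 0) +
        (if (x : ℕ) = (a : ℕ) + 1 then f a else 0) := by
    intro a
    simp only [neighbor_iff]
    split_ifs <;> first | omega | simp
  simp only [hsplit, Finset.sum_add_distrib]
  rw [Fin.sum_univ_eq_sum_range (fun a => if (x : ℕ) = a then f a else 0),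
    Fin.sum_univ_eq_sum_range (fun a => if (x : ℕ) + 1 = a then f a else 0),
    Fin.sum_univ_eq_sum_range (fun a => if (x : ℕ) = a + 1 then f a else 0)]
  congr 1
  · simp [hx]
  · split_ifs with h0
    · exact Finset.sum_eq_zero fun a _ => by rw [if_neg (by omega)]
    · rw [Finset.sum_eq_single ((x : ℕ) - 1)]
      · rw [if_pos (by omega)]
      · intro b _ hb
        rw [if_neg (by omega)]
      · intro hb
        exact absurd (Finset.mem_range.2 (by omega)) hb

/-- The operator is the Laplacian of a path with reflecting ends. It is solved by two summations:
the partial sums `R` of `r` are the flux, which vanishes at both ends (at the right one since `r`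
has mean zero), and the increments of `Q` are `-k` times the flux. -/
theorem poissonSolvable_accept {k : ℕ} : PoissonSolvable (accept (k := k)) := by
  intro r hr
  let ρ : ℕ → ℝ := fun j => if h : j < k then r ⟨j, h⟩ else 0
  let R : ℕ → ℝ := fun j => ∑ y ∈ Finset.range j, ρ y
  let Q : ℕ → ℝ := fun j => -k * ∑ i ∈ Finset.range j, R (i + 1)
  have hρ : ∀ x : Fin k, ρ x = r x := fun x => by simp [ρ]
  have hR0 : R 0 = 0 := by simp [R]
  have hRk : R k = 0 := by
    simp only [R]
    rw [← Fin.sum_univ_eq_sum_range ρ k, ← hr]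
    exact Finset.sum_congr rfl fun x _ => hρ x
  have hRs : ∀ j, R (j + 1) = R j + ρ j := fun j => Finset.sum_range_succ _ _
  have hQs : ∀ j, Q (j + 1) = Q j - k * R (j + 1) := by
    intro j
    simp only [Q, Finset.sum_range_succ]
    ring
  refine ⟨fun x => Q x, fun x => ?_⟩
  have hx := x.2
  have : ∀ a : Fin k, Q x - Q (accept x a) = if Neighbor x a then Q x - Q a else 0 := by
    intro a
    unfold accept
    split_ifs <;> simp
  simp only [this]
  rw [sum_neighbor x (fun j => Q x - Q j), ← hρ x]
  clear this
  generalize (x : ℕ) = z at hx ⊢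
  have hr1 := hRs z
  have hq1 := hQs z
  by_cases hl : z + 1 < k
  · rw [if_pos hl]
    rcases z with - | y
    · rw [if_pos rfl, hq1, hr1, hR0]; ring
    · have hq2 := hQs y
      rw [if_neg y.succ_ne_zero, hq1, hr1, Nat.add_sub_cancel, hq2]; ring
  · have hk : z + 1 = k := by omega
    rw [if_neg hl]
    rw [hk, hRk] at hr1
    rcases z with - | y
    · rw [if_pos rfl, show ρ 0 = 0 by linarith]; ring
    · have hq2 := hQs y
      rw [if_neg y.succ_ne_zero, Nat.add_sub_cancel, hq2,
        show R (y + 1) = - ρ (y + 1) by linarith]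
      ring

theorem sum_sum_neighbor {k : ℕ} (hk : 1 ≤ k) :
    ∑ x : Fin k, ∑ a : Fin k, (if Neighbor x a then (1 : ℝ) else 0) = 3 * k - 2 := by
  simp only [fun x : Fin k => sum_neighbor x (fun _ => 1)]
  obtain ⟨j, rfl⟩ : ∃ j, k = j + 1 := ⟨k - 1, by omega⟩
  rw [Fin.sum_univ_eq_sum_range (fun x => (1 : ℝ) + (if x + 1 < j + 1 then 1 else 0) +
    (if x = 0 then 0 else 1))]
  simp only [Finset.sum_add_distrib]
  rw [Finset.sum_range_succ (fun x => if x + 1 < j + 1 then (1 : ℝ) else 0),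
    Finset.sum_range_succ' (fun x => if x = 0 then (0 : ℝ) else 1),
    Finset.sum_congr rfl (fun x hx => if_pos (by have := Finset.mem_range.1 hx; omega))]
  simp
  ring

/-! ### Conditioning on all letters but the last -/

theorem dependsOn_chain {k : ℕ} (F : Fin k → Fin k → Fin k) (n : ℕ) :
    DependsOn (fun w => chain F w n) (Set.Iic n) := by
  intro w w' h
  induction n with
  | zero => exact h 0 (by simp)
  | succ n ih =>
    have := ih fun i hi => h i (Set.Iic_subset_Iic.2 n.le_succ hi)
    simp only [chain] at this ⊢
    rw [this, h (n + 1) (by simp)]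

theorem dependsOn_chainSum {k : ℕ} (F : Fin k → Fin k → Fin k) (g : Fin k → Fin k → ℝ) (n : ℕ) :
    DependsOn (fun w => chainSum F g w n) (Set.Iic n) := by
  intro w w' h
  refine Finset.sum_congr rfl fun m hm => ?_
  have hm' := Finset.mem_range.1 hm
  have := dependsOn_chain F m (x := w) (y := w') fun i hi =>
    h i (Set.Iic_subset_Iic.2 hm'.le hi)
  simp only at this
  rw [this, h (m + 1) (by simpa using hm')]

section

variable {k : ℕ} {Ω : Type*} [MeasurableSpace Ω] {w : ℕ → Ω → Fin k}

/-- A function of finitely many letters factors through a finite space, where every function is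
measurable and, for the next lemma, bounded. -/
theorem measurable_of_dependsOn {β : Type*} [MeasurableSpace β] [Nonempty β]
    {f : (ℕ → Fin k) → β} {n : ℕ} (hf : DependsOn f (Set.Iic n)) (hw : ∀ i, Measurable (w i)) :
    Measurable fun ω => f fun i => w i ω := by
  obtain ⟨g, rfl⟩ := dependsOn_iff_exists_comp.1 hf
  exact (measurable_of_finite g).comp (measurable_pi_lambda _ fun i => hw i)

theorem integrable_of_dependsOn {E : Type*} [NormedAddCommGroup E] [MeasurableSpace E]
    [BorelSpace E] [SecondCountableTopology E] {P : Measure Ω} [IsFiniteMeasure P]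
    {f : (ℕ → Fin k) → E} {n : ℕ} (hf : DependsOn f (Set.Iic n)) (hw : ∀ i, Measurable (w i)) :
    Integrable (fun ω => f fun i => w i ω) P := by
  have hm := measurable_of_dependsOn hf hw
  obtain ⟨g, rfl⟩ := dependsOn_iff_exists_comp.1 hf
  obtain ⟨C, hC⟩ := (Set.finite_range fun u => ‖g u‖).bddAbove
  exact Integrable.of_bound hm.aestronglyMeasurable C (ae_of_all _ fun ω => hC ⟨_, rfl⟩)

/-- Takes the place of conditional expectation given the first letters: split by the value of the
new letter, whose indicator is independent of the past and has mean `1 / k`. -/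
theorem integral_next_letter {E : Type*} [NormedAddCommGroup E] [NormedSpace ℝ E]
    [MeasurableSpace E] [BorelSpace E] [SecondCountableTopology E]
    {P : Measure Ω} [IsProbabilityMeasure P] (hw : IsUniformLetters P w) {n : ℕ}
    {H : (ℕ → Fin k) → Fin k → E} (hH : ∀ a, DependsOn (fun u => H u a) (Set.Iic n)) :
    ∫ ω, H (fun i => w i ω) (w (n + 1) ω) ∂P =
      (k : ℝ)⁻¹ • ∫ ω, ∑ a, H (fun i => w i ω) a ∂P := by
  have hmeas : ∀ a, Measurable fun ω => if w (n + 1) ω = a then (1 : ℝ) else 0 := fun a =>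
    Measurable.ite (hw.measurable _ (measurableSet_singleton a)) measurable_const measurable_const
  have hint : ∀ a, Integrable (fun ω => (if w (n + 1) ω = a then (1 : ℝ) else 0) •
      H (fun i => w i ω) a) P := by
    intro a
    refine (integrable_of_dependsOn (hH a) hw.measurable).bdd_smul 1
      (hmeas a).aestronglyMeasurable (ae_of_all _ fun ω => ?_)
    split_ifs <;> simp
  have hsum : ∀ ω, H (fun i => w i ω) (w (n + 1) ω) =
      ∑ a, (if w (n + 1) ω = a then (1 : ℝ) else 0) • H (fun i => w i ω) a := by
    intro ω
    simp [ite_smul]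
  simp only [hsum]
  rw [integral_finsetSum _ fun a _ => hint a,
    integral_finsetSum _ fun a _ => integrable_of_dependsOn (hH a) hw.measurable,
    Finset.smul_sum]
  refine Finset.sum_congr rfl fun a _ => ?_
  have hind : IndepFun (fun ω => if w (n + 1) ω = a then (1 : ℝ) else 0)
      (fun ω => H (fun i => w i ω) a) P := by
    have h0 := hw.indep.indepFun_finset {n + 1} (Finset.Iic n) (by simp) hw.measurable
    obtain ⟨g, hg⟩ := dependsOn_iff_exists_comp.1 ((Finset.coe_Iic n).symm ▸ hH a)
    have h1 := h0.comp (φ := fun u => if u ⟨n + 1, by simp⟩ = a then (1 : ℝ) else 0) (ψ := g)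
      (measurable_of_finite _) (measurable_of_finite _)
    have h2 : (g ∘ fun ω (i : Finset.Iic n) => w i ω) = fun ω => H (fun i => w i ω) a :=
      funext fun ω => (congrFun hg fun i => w i ω).symm
    exact h2 ▸ h1
  rw [hind.integral_fun_smul_eq_smul_integral (hmeas a).aestronglyMeasurable
    (measurable_of_dependsOn (hH a) hw.measurable).aestronglyMeasurable]
  congr 1
  have : (fun ω => if w (n + 1) ω = a then (1 : ℝ) else 0) =
      Set.indicator {ω | w (n + 1) ω = a} 1 := by
    ext ω; simp [Set.indicator_apply]
  rw [this, integral_indicator_one (s := {ω | w (n + 1) ω = a})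
      (hw.measurable _ (measurableSet_singleton a)),
    measureReal_def, hw.uniform]
  simp

end

/-! ### Strong law for martingale chain sums -/

theorem abs_chainSum_le {k : ℕ} {F : Fin k → Fin k → Fin k} {d : Fin k → Fin k → ℝ} {C : ℝ}
    (hC : ∀ x a, |d x a| ≤ C) (w : ℕ → Fin k) (n : ℕ) : |chainSum F d w n| ≤ C * n := by
  refine (Finset.abs_sum_le_sum_abs _ _).trans ?_
  refine (Finset.sum_le_sum fun m _ => hC _ _).trans ?_
  simp [mul_comm]

section

variable {k : ℕ} {Ω : Type*} [MeasurableSpace Ω] {w : ℕ → Ω → Fin k}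
  {P : Measure Ω} [IsProbabilityMeasure P]

theorem integral_pow_chainSum_succ (hw : IsUniformLetters P w) (F : Fin k → Fin k → Fin k)
    (d : Fin k → Fin k → ℝ) (p n : ℕ) :
    ∫ ω, chainSum F d (fun i => w i ω) (n + 1) ^ p ∂P =
      ∫ ω, (k : ℝ)⁻¹ * ∑ a, (chainSum F d (fun i => w i ω) n +
        d (chain F (fun i => w i ω) n) a) ^ p ∂P := by
  rw [integral_const_mul, ← smul_eq_mul, ← integral_next_letter hw (n := n)
    (H := fun u a => (chainSum F d u n + d (chain F u n) a) ^ p)]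
  · simp only [chainSum, Finset.sum_range_succ]
  · intro a u v huv
    have h1 := dependsOn_chain F n huv
    have h2 := dependsOn_chainSum F d n huv
    simp only at h1 h2 ⊢
    rw [h1, h2]

theorem integrable_pow_chainSum (hw : IsUniformLetters P w) (F : Fin k → Fin k → Fin k)
    (d : Fin k → Fin k → ℝ) (p n : ℕ) :
    Integrable (fun ω => chainSum F d (fun i => w i ω) n ^ p) P := by
  refine integrable_of_dependsOn (f := fun u => chainSum F d u n ^ p) (n := n) ?_ hw.measurable
  intro u v huv
  have h2 := dependsOn_chainSum F d n huv
  simp only at h2 ⊢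
  rw [h2]

theorem integral_sq_chainSum_le (hk : k ≠ 0) (hw : IsUniformLetters P w)
    (F : Fin k → Fin k → Fin k) {d : Fin k → Fin k → ℝ} {C : ℝ} (hC : ∀ x a, |d x a| ≤ C)
    (hd : ∀ x, ∑ a, d x a = 0) (n : ℕ) :
    ∫ ω, chainSum F d (fun i => w i ω) n ^ 2 ∂P ≤ C ^ 2 * n := by
  have hk' : (k : ℝ) ≠ 0 := Nat.cast_ne_zero.2 hk
  induction n with
  | zero => simp [chainSum]
  | succ n ih =>
    rw [integral_pow_chainSum_succ hw]
    have hpt : ∀ ω, (k : ℝ)⁻¹ * ∑ a, (chainSum F d (fun i => w i ω) n +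
        d (chain F (fun i => w i ω) n) a) ^ 2 ≤
          chainSum F d (fun i => w i ω) n ^ 2 + C ^ 2 := by
      intro ω
      generalize chainSum F d (fun i => w i ω) n = M
      generalize chain F (fun i => w i ω) n = x
      rw [inv_mul_le_iff₀ (by positivity)]
      calc ∑ a, (M + d x a) ^ 2 ≤ ∑ a : Fin k, (M ^ 2 + C ^ 2 + 2 * M * d x a) := by
            refine Finset.sum_le_sum fun a _ => ?_
            have := sq_le_sq' (abs_le.1 (hC x a)).1 (abs_le.1 (hC x a)).2
            linarith [this]
        _ = k * (M ^ 2 + C ^ 2) := by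
            rw [Finset.sum_add_distrib, ← Finset.mul_sum, hd]
            simp
            ring
    have h1 := integrable_pow_chainSum hw F d 2 n
    refine (integral_mono_of_nonneg (ae_of_all _ fun ω => ?_)
      (h1.add (integrable_const (C ^ 2))) (ae_of_all _ hpt)).trans ?_
    · simp only [Pi.zero_apply]
      positivity
    · simp only [Pi.add_apply]
      rw [integral_add h1 (integrable_const _), integral_const]
      simp
      linarith

/-- In the binomial expansion the term linear in `d` averages to zero. The quadratic term is
controlled by the second moment, the cubic one by the crude bound `|M| ≤ C n`. The increment is at
most `C ^ 4 (10 n + 1)`, so 11 is ample. -/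
theorem integral_pow_four_chainSum_le (hk : k ≠ 0) (hw : IsUniformLetters P w)
    (F : Fin k → Fin k → Fin k) {d : Fin k → Fin k → ℝ} {C : ℝ} (hC : ∀ x a, |d x a| ≤ C)
    (hd : ∀ x, ∑ a, d x a = 0) (n : ℕ) :
    ∫ ω, chainSum F d (fun i => w i ω) n ^ 4 ∂P ≤ 11 * C ^ 4 * n ^ 2 := by
  have hk' : (k : ℝ) ≠ 0 := Nat.cast_ne_zero.2 hk
  induction n with
  | zero => simp [chainSum]
  | succ n ih =>
    rw [integral_pow_chainSum_succ hw]
    have hpt : ∀ ω, (k : ℝ)⁻¹ * ∑ a, (chainSum F d (fun i => w i ω) n +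
        d (chain F (fun i => w i ω) n) a) ^ 4 ≤
          (chainSum F d (fun i => w i ω) n ^ 4 +
            6 * C ^ 2 * chainSum F d (fun i => w i ω) n ^ 2) + (4 * C ^ 4 * n + C ^ 4) := by
      intro ω
      have hM := abs_chainSum_le (F := F) hC (fun i => w i ω) n
      generalize chainSum F d (fun i => w i ω) n = M at hM ⊢
      generalize chain F (fun i => w i ω) n = x
      rw [inv_mul_le_iff₀ (by positivity)]
      calc ∑ a, (M + d x a) ^ 4 ≤ ∑ a : Fin k, ((M ^ 4 + 6 * C ^ 2 * M ^ 2) +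
              (4 * C ^ 4 * n + C ^ 4) + 4 * M ^ 3 * d x a) := by
            refine Finset.sum_le_sum fun a _ => ?_
            have hC0 : 0 ≤ C := (abs_nonneg _).trans (hC x a)
            have h2 : d x a ^ 2 ≤ C ^ 2 := sq_le_sq' (abs_le.1 (hC x a)).1 (abs_le.1 (hC x a)).2
            have h4 : d x a ^ 4 ≤ C ^ 4 := by
              calc d x a ^ 4 = (d x a ^ 2) ^ 2 := by ring
                _ ≤ (C ^ 2) ^ 2 := pow_le_pow_left₀ (sq_nonneg _) h2 2
                _ = C ^ 4 := by ring
            have h3 : M * d x a ^ 3 ≤ C ^ 4 * n := by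
              calc M * d x a ^ 3 ≤ |M * d x a ^ 3| := le_abs_self _
                _ = |M| * |d x a| ^ 3 := by rw [abs_mul, abs_pow]
                _ ≤ (C * n) * C ^ 3 := by
                  gcongr
                  exact hC x a
                _ = C ^ 4 * n := by ring
            have h2' : d x a ^ 2 * M ^ 2 ≤ C ^ 2 * M ^ 2 := by gcongr
            linarith [show (M + d x a) ^ 4 = M ^ 4 + 4 * M ^ 3 * d x a + 6 * (d x a ^ 2 * M ^ 2) +
              4 * (M * d x a ^ 3) + d x a ^ 4 by ring]
        _ = k * ((M ^ 4 + 6 * C ^ 2 * M ^ 2) + (4 * C ^ 4 * n + C ^ 4)) := by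
            rw [Finset.sum_add_distrib, ← Finset.mul_sum, hd]
            simp
            ring
    have h2 := (integrable_pow_chainSum hw F d 2 n).const_mul (6 * C ^ 2)
    have h4 := integrable_pow_chainSum hw F d 4 n
    refine (integral_mono_of_nonneg (ae_of_all _ fun ω => ?_)
      ((h4.add h2).add (integrable_const (4 * C ^ 4 * n + C ^ 4))) (ae_of_all _ hpt)).trans ?_
    · simp only [Pi.zero_apply]
      exact mul_nonneg (by positivity) (Finset.sum_nonneg fun a _ => by positivity)
    · have hs := mul_le_mul_of_nonneg_left (integral_sq_chainSum_le hk hw F hC hd n)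
        (show 0 ≤ 6 * C ^ 2 by positivity)
      have h42 : Integrable (fun ω => chainSum F d (fun i => w i ω) n ^ 4 +
        6 * C ^ 2 * chainSum F d (fun i => w i ω) n ^ 2) P := h4.add h2
      simp only [Pi.add_apply]
      rw [integral_add h42 (integrable_const _), integral_add h4 h2, integral_const_mul,
        integral_const]
      simp only [probReal_univ, one_smul]
      push_cast
      have : 0 ≤ C ^ 4 * n := by positivity
      have : 0 ≤ C ^ 4 := by positivity
      nlinarith

theorem ae_tendsto_chainSum_div (hk : k ≠ 0) (hw : IsUniformLetters P w)
    (F : Fin k → Fin k → Fin k) {d : Fin k → Fin k → ℝ} (hd : ∀ x, ∑ a, d x a = 0) :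
    ∀ᵐ ω ∂P, Tendsto (fun n : ℕ => chainSum F d (fun i => w i ω) n / n) atTop (𝓝 0) := by
  obtain ⟨C, hC⟩ : ∃ C, ∀ x a, |d x a| ≤ C := by
    obtain ⟨C, hC⟩ := (Set.finite_range fun p : Fin k × Fin k => |d p.1 p.2|).bddAbove
    exact ⟨C, fun x a => hC ⟨(x, a), rfl⟩⟩
  have hmeas : ∀ n, Measurable fun ω => chainSum F d (fun i => w i ω) n := fun n =>
    measurable_of_dependsOn (dependsOn_chainSum F d n) hw.measurable
  let f : ℕ → Ω → ENNReal := fun n ω =>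
    ENNReal.ofReal ((chainSum F d (fun i => w i ω) n / n) ^ 4)
  have hf : ∀ n, Measurable (f n) := fun n =>
    (((hmeas n).div_const _).pow_const 4).ennreal_ofReal
  have hle : ∀ n, ∫⁻ ω, f n ω ∂P ≤ ENNReal.ofReal (11 * C ^ 4 * (1 / (n : ℝ) ^ 2)) := by
    intro n
    have hi : Integrable (fun ω => (chainSum F d (fun i => w i ω) n / n) ^ 4) P := by
      simp only [div_pow]
      exact (integrable_pow_chainSum hw F d 4 n).div_const _
    rw [← ofReal_integral_eq_lintegral_ofReal hi (ae_of_all _ fun ω => by positivity)]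
    refine ENNReal.ofReal_le_ofReal ?_
    simp only [div_pow]
    rw [integral_div]
    rcases Nat.eq_zero_or_pos n with rfl | hn
    · simp
    · rw [div_le_iff₀ (by positivity)]
      refine (integral_pow_four_chainSum_le hk hw F hC hd n).trans_eq ?_
      field_simp
  have hfin : ∫⁻ ω, ∑' n, f n ω ∂P ≠ ⊤ := by
    rw [lintegral_tsum fun n => (hf n).aemeasurable]
    refine ne_top_of_le_ne_top ?_ (ENNReal.tsum_le_tsum hle)
    have hs : Summable fun n : ℕ => 11 * C ^ 4 * (1 / (n : ℝ) ^ 2) :=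
      (Real.summable_one_div_nat_pow.2 one_lt_two).mul_left _
    rw [← ENNReal.ofReal_tsum_of_nonneg (fun n => by positivity) hs]
    exact ENNReal.ofReal_ne_top
  filter_upwards [ae_lt_top (Measurable.tsum hf) hfin] with ω hω
  have h0 := ENNReal.tendsto_atTop_zero_of_tsum_ne_top hω.ne
  have h1 : Tendsto (fun n : ℕ => (chainSum F d (fun i => w i ω) n / n) ^ 4) atTop (𝓝 0) := by
    have := (ENNReal.tendsto_toReal ENNReal.zero_ne_top).comp h0
    refine (this.congr fun n => ?_)
    simp only [Function.comp, f]
    rw [ENNReal.toReal_ofReal (by positivity)]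
  refine squeeze_zero_norm (a := fun n : ℕ =>
    ((chainSum F d (fun i => w i ω) n / n) ^ 4) ^ ((1 : ℝ) / 4)) (fun n => ?_) ?_
  · rw [← Even.pow_abs (by decide : Even 4), ← Real.rpow_natCast, ← Real.rpow_mul (abs_nonneg _)]
    norm_num [abs_div]
  · have := h1.rpow_const (p := (1 : ℝ) / 4) (Or.inr (by norm_num))
    simpa using this

end

/-! ### Central limit theorem for martingale chain sums -/

open Asymptotics Complex in
theorem cexp_expansion (α β : ℝ) :
    (fun s : ℝ => cexp (α * s * I + β * s ^ 2) - (1 + α * s * I + (β - α ^ 2 / 2) * s ^ 2))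
      =O[𝓝 0] fun s : ℝ => s ^ 3 := by
  let z : ℝ → ℂ := fun s => α * s * I + β * s ^ 2
  have hzc : Continuous z := by fun_prop
  have hz0 : Tendsto z (𝓝 0) (𝓝 0) := by
    have := hzc.tendsto 0
    simpa [z] using this
  have hcont : ∀ f : ℝ → ℂ, Continuous f → (fun s => f s) =O[𝓝 (0 : ℝ)] fun _ => (1 : ℝ) :=
    fun f hf => (hf.tendsto 0).isBigO_one ℝ
  have hz : z =O[𝓝 0] fun s : ℝ => s := by
    have := (hcont (fun s => α * I + β * s) (by fun_prop)).mul
      (isBigO_of_le (g := fun s : ℝ => s) (f := fun s : ℝ => (s : ℂ)) (𝓝 0) fun s => by simp)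
    refine this.congr (fun s => ?_) fun s => by ring
    simp only [z]
    ring
  have h1 := ((exp_sub_sum_range_isBigO_pow 3).comp_tendsto hz0).trans (hz.pow 3)
  -- These are the terms of order three and four in `z ^ 2 / 2`, which the quadratic polynomial
  -- omits.
  have h2 : (fun s : ℝ => (α * β * I + β ^ 2 / 2 * s : ℂ) * (s : ℂ) ^ 3) =O[𝓝 0]
      fun s : ℝ => s ^ 3 := by
    have := (hcont (fun s => α * β * I + β ^ 2 / 2 * s) (by fun_prop)).mul
      (isBigO_of_le (g := fun s : ℝ => s ^ 3) (f := fun s : ℝ => (s : ℂ) ^ 3) (𝓝 0)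
        fun s => by simp)
    exact this.congr (fun s => rfl) fun s => by ring
  refine (h1.add h2).congr_left fun s => ?_
  simp only [Function.comp, Finset.sum_range_succ, Finset.range_zero, Finset.sum_empty, z]
  norm_num [Nat.factorial]
  linear_combination (-(α ^ 2 * s ^ 2 / 2) : ℂ) * I_sq

section

variable {k : ℕ} {Ω : Type*} [MeasurableSpace Ω] {w : ℕ → Ω → Fin k}
  {P : Measure Ω} [IsProbabilityMeasure P]

open Complex in
-- `hd` cancels the first-order terms in `s` and `hq` says exactly that the second-order ones agree,
-- leaving a cubic remainder.
theorem norm_cexp_chainSum_sub_le (hk : k ≠ 0) (F : Fin k → Fin k → Fin k)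
    {d : Fin k → Fin k → ℝ} {q : Fin k → ℝ} {σ : ℝ} (hd : ∀ x, ∑ a, d x a = 0)
    (hq : ∀ x, ∑ a, (q x - q (F x a)) = ∑ a, d x a ^ 2 - k * σ ^ 2) :
    ∃ K : ℝ, ∀ᶠ s : ℝ in 𝓝 0, ∀ x, ‖(k : ℂ)⁻¹ * ∑ a, cexp (d x a * s * I +
      (-(q (F x a)) / 2 : ℝ) * s ^ 2) - cexp ((-(σ ^ 2) / 2 : ℝ) * s ^ 2) *
        cexp ((-(q x) / 2 : ℝ) * s ^ 2)‖ ≤ K * |s| ^ 3 := by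
  have hk' : (k : ℂ) ≠ 0 := Nat.cast_ne_zero.2 hk
  have hO : ∀ x, (fun s : ℝ => (k : ℂ)⁻¹ * ∑ a, cexp (d x a * s * I +
      (-(q (F x a)) / 2 : ℝ) * s ^ 2) - cexp ((-(σ ^ 2) / 2 : ℝ) * s ^ 2) *
        cexp ((-(q x) / 2 : ℝ) * s ^ 2)) =O[𝓝 0] fun s : ℝ => s ^ 3 := by
    intro x
    have h1 := (Asymptotics.IsBigO.fun_sum (s := Finset.univ) fun a _ =>
      cexp_expansion (d x a) (-(q (F x a)) / 2)).const_mul_left (k : ℂ)⁻¹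
    have h2 := cexp_expansion 0 (-(σ ^ 2 + q x) / 2)
    refine (h1.sub h2).congr_left fun s => ?_
    have hd' : ∑ a, (d x a : ℂ) = 0 := by exact_mod_cast hd x
    have hq' : (k : ℂ) * q x - ∑ a, (q (F x a) : ℂ) = ∑ a, (d x a : ℂ) ^ 2 - k * σ ^ 2 := by
      have := hq x
      rw [Finset.sum_sub_distrib] at this
      simp only [Finset.sum_const, Finset.card_univ, Fintype.card_fin, nsmul_eq_mul] at this
      exact_mod_cast this
    rw [← Complex.exp_add, ← add_mul, Finset.sum_sub_distrib, mul_sub]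
    have hmain : (k : ℂ)⁻¹ * ∑ a, (1 + d x a * s * I +
        ((-(q (F x a)) / 2 : ℝ) - d x a ^ 2 / 2) * s ^ 2 : ℂ) =
          1 + ((-(σ ^ 2 + q x) / 2 : ℝ) : ℂ) * s ^ 2 := by
      rw [inv_mul_eq_iff_eq_mul₀ hk', Finset.sum_add_distrib, Finset.sum_add_distrib,
        ← Finset.sum_mul, ← Finset.sum_mul, ← Finset.sum_mul, hd', Finset.sum_sub_distrib]
      push_cast
      rw [← Finset.sum_div, ← Finset.sum_div, Finset.sum_neg_distrib]
      simp only [Finset.sum_const, Finset.card_univ, Fintype.card_fin, nsmul_eq_mul]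
      linear_combination (s : ℂ) ^ 2 / 2 * hq'
    rw [hmain]
    push_cast
    simp
    ring_nf
  choose c hc using fun x => (hO x).bound
  refine ⟨∑ x, |c x|, (eventually_all.2 hc).mono fun s hs x => (hs x).trans ?_⟩
  rw [norm_pow, Real.norm_eq_abs]
  gcongr
  exact (le_abs_self _).trans
    (Finset.single_le_sum (f := fun x => |c x|) (fun x _ => abs_nonneg _) (Finset.mem_univ x))

open Complex in
-- `u` is an approximate eigenfunction, with eigenvalue `c`, of the transition operator twisted by
-- `exp (i s d)`. Since `‖c‖ ≤ 1` the one-step errors `ε` only add up; replacing `u` by 1 at time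
-- `n` and at time 0 costs `δ` each.
theorem norm_integral_cexp_chainSum_sub_le (hk : k ≠ 0) (hw : IsUniformLetters P w)
    (F : Fin k → Fin k → Fin k) (d : Fin k → Fin k → ℝ) (u : Fin k → ℂ) (c : ℂ) (s ε δ : ℝ)
    (hc : ‖c‖ ≤ 1) (hδ : ∀ x, ‖u x - 1‖ ≤ δ)
    (hε : ∀ x, ‖(k : ℂ)⁻¹ * ∑ a, cexp (d x a * s * I) * u (F x a) - c * u x‖ ≤ ε) (n : ℕ) :
    ‖∫ ω, cexp (s * chainSum F d (fun i => w i ω) n * I) ∂P - c ^ n‖ ≤ 2 * δ + n * ε := by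
  have hne : Nonempty (Fin k) := ⟨⟨0, Nat.pos_of_ne_zero hk⟩⟩
  have hδ0 : 0 ≤ δ := (norm_nonneg _).trans (hδ hne.some)
  let f : ℕ → (ℕ → Fin k) → ℂ := fun n v => cexp (s * chainSum F d v n * I)
  have hfn : ∀ n v, ‖f n v‖ = 1 := fun n v => by
    simp only [f]
    exact_mod_cast norm_exp_ofReal_mul_I (s * chainSum F d v n)
  have hdep : ∀ n, DependsOn (f n) (Set.Iic n) := fun n v v' h => by
    have := dependsOn_chainSum F d n h
    simp only [f] at this ⊢
    rw [this]
  have hdep' : ∀ (g : Fin k → ℂ) n, DependsOn (fun v => f n v * g (chain F v n)) (Set.Iic n) :=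
    fun g n v v' h => by
      have h1 := dependsOn_chain F n h
      have h2 := hdep n h
      simp only at h1 h2 ⊢
      rw [h1, h2]
  have hint : ∀ (g : Fin k → ℂ) n,
      Integrable (fun ω => f n (fun i => w i ω) * g (chain F (fun i => w i ω) n)) P :=
    fun g n => integrable_of_dependsOn (hdep' g n) hw.measurable
  have hbound : ∀ (g : Fin k → ℂ) (B : ℝ) n, (∀ x, ‖g x‖ ≤ B) →
      ‖∫ ω, f n (fun i => w i ω) * g (chain F (fun i => w i ω) n) ∂P‖ ≤ B := by
    intro g B n hg
    refine (norm_integral_le_of_norm_le_const (ae_of_all _ fun ω => ?_)).trans_eq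
      (by rw [probReal_univ, mul_one])
    rw [norm_mul, hfn, one_mul]
    exact hg _
  let A : ℕ → ℂ := fun n => ∫ ω, f n (fun i => w i ω) * u (chain F (fun i => w i ω) n) ∂P
  have hstep : ∀ n, ‖A (n + 1) - c * A n‖ ≤ ε := by
    intro n
    have h1 : A (n + 1) = ∫ ω, f n (fun i => w i ω) * ((k : ℂ)⁻¹ * ∑ a, cexp
        (d (chain F (fun i => w i ω) n) a * s * I) * u (F (chain F (fun i => w i ω) n) a)) ∂P := by
      have hH : ∀ a, DependsOn (fun v => f n v * (cexp (d (chain F v n) a * s * I) *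
        u (F (chain F v n) a))) (Set.Iic n) := fun a =>
          hdep' (fun x => cexp (d x a * s * I) * u (F x a)) n
      have := integral_next_letter hw hH
      rw [← integral_smul] at this
      convert this using 1
      · simp only [A, f, chain, chainSum, Finset.sum_range_succ]
        congr 1
        ext ω
        rw [← mul_assoc, ← Complex.exp_add]
        push_cast
        ring_nf
      · congr 1
        ext ω
        rw [← Finset.mul_sum, Complex.real_smul]
        push_cast
        ring
    have h2 : c * A n = ∫ ω, f n (fun i => w i ω) * (c * u (chain F (fun i => w i ω) n)) ∂P := by
      simp only [A]
      rw [← integral_const_mul]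
      congr 1
      ext ω
      ring
    rw [h1, h2, ← integral_sub (hint (fun x => (k : ℂ)⁻¹ * ∑ a, cexp (d x a * s * I) *
      u (F x a)) n) (hint (fun x => c * u x) n)]
    simp only [← mul_sub]
    exact hbound (fun x => (k : ℂ)⁻¹ * ∑ a, cexp (d x a * s * I) * u (F x a) - c * u x) ε n hε
  have hiter : ∀ n : ℕ, ‖A n - c ^ n * A 0‖ ≤ n * ε := by
    intro n
    induction n with
    | zero => simp
    | succ n ih =>
      calc ‖A (n + 1) - c ^ (n + 1) * A 0‖
          = ‖(A (n + 1) - c * A n) + c * (A n - c ^ n * A 0)‖ := by congr 1; ring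
        _ ≤ ε + 1 * (n * ε) := by
          refine (norm_add_le _ _).trans (add_le_add (hstep n) ?_)
          rw [norm_mul]
          exact mul_le_mul hc ih (norm_nonneg _) zero_le_one
        _ = ((n + 1 : ℕ) : ℝ) * ε := by push_cast; ring
  have hA : ∀ n, ‖A n - ∫ ω, f n (fun i => w i ω) ∂P‖ ≤ δ := by
    intro n
    have := hint (fun _ => 1) n
    simp only [mul_one] at this
    rw [← integral_sub (hint u n) this]
    have hb := hbound (fun x => u x - 1) δ n hδ
    simpa only [mul_sub, mul_one] using hb
  have h0 : ∫ ω, f 0 (fun i => w i ω) ∂P = 1 := by simp [f, chainSum]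
  have hA0 := hA 0
  rw [h0] at hA0
  calc ‖∫ ω, f n (fun i => w i ω) ∂P - c ^ n‖
      = ‖-(A n - ∫ ω, f n (fun i => w i ω) ∂P) + (A n - c ^ n * A 0) + c ^ n * (A 0 - 1)‖ := by
        congr 1; ring
    _ ≤ δ + n * ε + 1 * δ := by
        refine (norm_add₃_le).trans (add_le_add_three ?_ (hiter n) ?_)
        · rw [norm_neg]; exact hA n
        · rw [norm_mul, norm_pow]
          exact mul_le_mul (pow_le_one₀ (norm_nonneg _) hc) hA0 (norm_nonneg _) zero_le_one
    _ = 2 * δ + n * ε := by ring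

open Complex in
theorem tendstoInDistribution_chainSum (hk : k ≠ 0) (hw : IsUniformLetters P w)
    (F : Fin k → Fin k → Fin k) {d : Fin k → Fin k → ℝ} {q : Fin k → ℝ} {σ : ℝ} (hσ : 0 < σ)
    (hd : ∀ x, ∑ a, d x a = 0)
    (hq : ∀ x, ∑ a, (q x - q (F x a)) = ∑ a, d x a ^ 2 - k * σ ^ 2) :
    TendstoInDistribution (fun (n : ℕ) ω => chainSum F d (fun i => w i ω) n / (σ * √(n : ℝ)))
      atTop (id : ℝ → ℝ) (fun _ => P) (gaussianReal 0 1) := by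
  have hmeas : ∀ n : ℕ, Measurable fun ω => chainSum F d (fun i => w i ω) n / (σ * √(n : ℝ)) :=
    fun n => (measurable_of_dependsOn (dependsOn_chainSum F d n) hw.measurable).div_const _
  refine ⟨fun n => (hmeas n).aemeasurable, aemeasurable_id, ?_⟩
  refine ProbabilityMeasure.tendsto_iff_tendsto_charFun.2 fun t => ?_
  simp only [ProbabilityMeasure.coe_mk, Measure.map_id, charFun_gaussianReal]
  obtain ⟨K, hK⟩ := norm_cexp_chainSum_sub_le hk F hd hq
  let s : ℕ → ℝ := fun n => t / (σ * √(n : ℝ))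
  have hsqrt : Tendsto (fun n : ℕ => √(n : ℝ)) atTop atTop :=
    Real.tendsto_sqrt_atTop.comp tendsto_natCast_atTop_atTop
  have hs : Tendsto s atTop (𝓝 0) :=
    tendsto_const_nhds.div_atTop (hsqrt.const_mul_atTop hσ)
  let δ : ℝ → ℝ := fun s => ∑ x, ‖cexp ((-(q x) / 2 : ℝ) * s ^ 2) - 1‖
  have hδ : Tendsto (fun n => δ (s n)) atTop (𝓝 0) := by
    have hc : Continuous δ := by fun_prop
    have h0 : δ 0 = 0 := by simp [δ]
    exact h0 ▸ (hc.tendsto 0).comp hs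
  have hε : Tendsto (fun n : ℕ => n * (K * |s n| ^ 3)) atTop (𝓝 0) := by
    have h1 : Tendsto (fun n => K * (t / σ) ^ 2 * |s n|) atTop (𝓝 0) := by
      simpa using hs.abs.const_mul (K * (t / σ) ^ 2)
    refine h1.congr' ?_
    filter_upwards [eventually_gt_atTop 0] with n hn
    have hn' : (0 : ℝ) < n := Nat.cast_pos.2 hn
    have : s n ^ 2 = (t / σ) ^ 2 / n := by
      simp only [s]
      rw [div_pow, mul_pow, Real.sq_sqrt hn'.le]
      field_simp
    rw [pow_succ |s n|, sq_abs, this]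
    field_simp
  have hlim : Tendsto (fun n : ℕ => 2 * δ (s n) + n * (K * |s n| ^ 3)) atTop (𝓝 0) := by
    simpa using (hδ.const_mul 2).add hε
  rw [tendsto_iff_norm_sub_tendsto_zero]
  refine squeeze_zero' (Eventually.of_forall fun _ => norm_nonneg _) ?_ hlim
  filter_upwards [hs.eventually hK, eventually_gt_atTop 0] with n hKn hn
  have hn' : (0 : ℝ) < n := Nat.cast_pos.2 hn
  have hmain := norm_integral_cexp_chainSum_sub_le hk hw F d
    (fun x => cexp ((-(q x) / 2 : ℝ) * (s n) ^ 2)) (cexp ((-(σ ^ 2) / 2 : ℝ) * (s n) ^ 2)) (s n)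
    (K * |s n| ^ 3) (δ (s n)) ?_ ?_ ?_ n
  · have hchar : charFun (P.map fun ω => chainSum F d (fun i => w i ω) n / (σ * √(n : ℝ))) t =
        ∫ ω, cexp (s n * chainSum F d (fun i => w i ω) n * I) ∂P := by
      rw [charFun_apply_real, integral_map (hmeas n).aemeasurable (by fun_prop)]
      congr 1
      ext ω
      simp only [s]
      push_cast
      ring_nf
    -- The choice of `s n` makes the `n`-th power of the eigenvalue equal to the Gaussian
    -- characteristic function exactly.
    have hpow : cexp (t * (0 : ℝ) * I - (1 : NNReal) * t ^ 2 / 2) =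
        cexp ((-(σ ^ 2) / 2 : ℝ) * (s n) ^ 2) ^ n := by
      rw [← Complex.exp_nat_mul]
      congr 1
      have : (n : ℝ) * (-(σ ^ 2) / 2 * (s n) ^ 2) = -t ^ 2 / 2 := by
        simp only [s]
        rw [div_pow, mul_pow, Real.sq_sqrt hn'.le]
        field_simp
      have h2 : (n : ℂ) * (((-(σ ^ 2) / 2 : ℝ) : ℂ) * (s n : ℂ) ^ 2) = -(t : ℂ) ^ 2 / 2 := by
        exact_mod_cast congrArg (fun r : ℝ => (r : ℂ)) this
      rw [h2]
      simp [neg_div]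
    rw [hpow]
    exact hchar ▸ hmain
  · rw [norm_exp]
    have : (((-(σ ^ 2) / 2 : ℝ) : ℂ) * (s n : ℂ) ^ 2).re = -(σ ^ 2) / 2 * (s n) ^ 2 := by
      rw [← ofReal_pow, ← ofReal_mul, ofReal_re]
    rw [this, Real.exp_le_one_iff]
    have : 0 ≤ σ ^ 2 * (s n) ^ 2 := by positivity
    linarith
  · intro x
    exact Finset.single_le_sum (f := fun x => ‖cexp ((-(q x) / 2 : ℝ) * (s n) ^ 2) - 1‖)
      (fun x _ => norm_nonneg _) (Finset.mem_univ x)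
  · intro x
    have := hKn x
    simp only [Complex.exp_add] at this
    exact this

end

/-! ### Limit laws for additive functionals -/

theorem exists_limit_laws {k : ℕ} (hk : k ≠ 0) {F : Fin k → Fin k → Fin k}
    (hF : PoissonSolvable F) {g : Fin k → Fin k → ℝ} {φ : ℝ}
    (hφ : ∑ x, ∑ a, g x a = (k : ℝ) ^ 2 * φ) (hpos : ∃ x a, F x a = x ∧ g x a ≠ φ) (C : ℝ) :
    ∃ σ : ℝ, 0 < σ ∧ ∀ (Ω : Type*) [MeasurableSpace Ω] (P : Measure Ω) [IsProbabilityMeasure P]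
      (w : ℕ → Ω → Fin k), IsUniformLetters P w → ∀ c : ℕ → Ω → ℕ, (∀ n, Measurable (c n)) →
      (∀ n ω, |(c n ω : ℝ) - chainSum F g (fun i => w i ω) n| ≤ C) →
      (∀ᵐ ω ∂P, Tendsto (fun n : ℕ => (c n ω : ℝ) / n) atTop (𝓝 φ)) ∧
      TendstoInDistribution (fun (n : ℕ) ω => ((c n ω : ℝ) - φ * n) / (σ * √(n : ℝ)))
        atTop (id : ℝ → ℝ) (fun _ => P) (gaussianReal 0 1) := by
  have hk' : (k : ℝ) ≠ 0 := Nat.cast_ne_zero.2 hk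
  obtain ⟨h, hh⟩ := hF (fun x => (k : ℝ)⁻¹ * ∑ a, g x a - φ) (by
    rw [Finset.sum_sub_distrib, ← Finset.mul_sum, hφ]
    simp
    field_simp
    ring)
  let d : Fin k → Fin k → ℝ := fun x a => g x a - φ + h (F x a) - h x
  have hd : ∀ x, ∑ a, d x a = 0 := by
    intro x
    have := hh x
    rw [mul_sub, mul_inv_cancel_left₀ hk'] at this
    simp only [d, Finset.sum_sub_distrib, Finset.sum_add_distrib] at this ⊢
    simp at this ⊢
    linarith
  -- The stationary variance of `d`: the only constant that gives the second Poisson equation a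
  -- right-hand side of mean zero.
  let v : ℝ := ((k : ℝ) ^ 2)⁻¹ * ∑ x, ∑ a, d x a ^ 2
  have hv : 0 < v := by
    obtain ⟨x, a, hxa, hg⟩ := hpos
    have hda : d x a ≠ 0 := by
      simp only [d, hxa]
      rwa [add_sub_cancel_right, sub_ne_zero]
    refine mul_pos (by positivity) ?_
    refine Finset.sum_pos' (fun _ _ => Finset.sum_nonneg fun _ _ => sq_nonneg _)
      ⟨x, Finset.mem_univ _, Finset.sum_pos' (fun _ _ => sq_nonneg _) ⟨a, Finset.mem_univ _, ?_⟩⟩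
    positivity
  obtain ⟨q, hq⟩ := hF (fun x => (k : ℝ)⁻¹ * ∑ a, d x a ^ 2 - v) (by
    rw [Finset.sum_sub_distrib, ← Finset.mul_sum]
    simp [v]
    field_simp
    ring)
  have hq' : ∀ x, ∑ a, (q x - q (F x a)) = ∑ a, d x a ^ 2 - k * √v ^ 2 := by
    intro x
    rw [hq x, Real.sq_sqrt hv.le, mul_sub, mul_inv_cancel_left₀ hk']
  have hsum : ∀ (u : ℕ → Fin k) n, chainSum F d u n =
      chainSum F g u n - φ * n + h (chain F u n) - h (chain F u 0) := by
    intro u n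
    induction n with
    | zero => simp [chainSum]
    | succ n ih =>
      simp only [chainSum, Finset.sum_range_succ, d, chain] at ih ⊢
      push_cast
      linarith
  obtain ⟨B, hB⟩ := (Set.finite_range fun x => |h x|).bddAbove
  have hB' : ∀ x, |h x| ≤ B := fun x => hB ⟨x, rfl⟩
  refine ⟨√v, Real.sqrt_pos.2 hv, fun Ω _ P _ w hw c hcm hc => ?_⟩
  have hclose : ∀ n ω, |((c n ω : ℝ) - φ * n) - chainSum F d (fun i => w i ω) n| ≤
      C + B + B := by
    intro n ω
    have h1 := abs_le.1 (hc n ω)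
    have h2 := abs_le.1 (hB' (chain F (fun i => w i ω) n))
    have h3 := abs_le.1 (hB' (chain F (fun i => w i ω) 0))
    rw [hsum, abs_le]
    constructor <;> linarith
  constructor
  · filter_upwards [ae_tendsto_chainSum_div hk hw F hd] with ω hω
    have h1 : Tendsto (fun n : ℕ => ((c n ω : ℝ) - φ * n - chainSum F d (fun i => w i ω) n) / n)
        atTop (𝓝 0) := by
      refine squeeze_zero_norm (a := fun n : ℕ => (C + B + B) / n) (fun n => ?_)
        (tendsto_const_nhds.div_atTop tendsto_natCast_atTop_atTop)
      rw [norm_div, Real.norm_eq_abs, Real.norm_natCast]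
      exact div_le_div_of_nonneg_right (hclose n ω) (Nat.cast_nonneg n)
    have h2 := (h1.add hω).const_add φ
    rw [add_zero, add_zero] at h2
    refine h2.congr' ?_
    filter_upwards [eventually_gt_atTop 0] with n hn
    have hn' : (n : ℝ) ≠ 0 := Nat.cast_ne_zero.2 hn.ne'
    field_simp
    ring
  · have hlim := tendstoInDistribution_chainSum hk hw F (Real.sqrt_pos.2 hv) hd hq'
    have hcm' : ∀ n : ℕ, AEMeasurable (fun ω => ((c n ω : ℝ) - φ * n) / (√v * √(n : ℝ))) P :=
      fun n => (((measurable_from_top.comp (hcm n)).sub_const _).div_const _).aemeasurable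
    refine tendstoInDistribution_of_tendstoInMeasure_sub _ _ hlim ?_ hcm'
    have hb : Tendsto (fun n : ℕ => (C + B + B) / (√v * √(n : ℝ))) atTop (𝓝 0) :=
      tendsto_const_nhds.div_atTop <| (Real.tendsto_sqrt_atTop.comp
        tendsto_natCast_atTop_atTop).const_mul_atTop (Real.sqrt_pos.2 hv)
    refine tendstoInMeasure_of_tendsto_ae (fun n => ?_) (ae_of_all _ fun ω => ?_)
    · exact ((hcm' n).sub (hlim.forall_aemeasurable n)).aestronglyMeasurable
    · refine squeeze_zero_norm (fun n => ?_) hb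
      simp only [Pi.sub_apply]
      rw [← sub_div, norm_div, Real.norm_eq_abs,
        Real.norm_of_nonneg (show 0 ≤ √v * √(n : ℝ) by positivity)]
      exact div_le_div_of_nonneg_right (hclose n ω) (by positivity)

theorem measurable_comp_randomWord {k : ℕ} {Ω : Type*} [MeasurableSpace Ω] {w : ℕ → Ω → Fin k}
    (hw : ∀ i, Measurable (w i)) (f : List (Fin k) → ℕ) (n : ℕ) :
    Measurable fun ω => f (randomWord w n ω) := by
  have : Measurable fun ω (i : Fin n) => w i ω := measurable_pi_lambda _ fun i => hw i
  exact (measurable_of_finite fun u : Fin n → Fin k => f (List.ofFn u)).comp this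

/-- A word of `n` letters has only `n - 1` transitions, so the chain sum reads one letter beyond it.
-/
theorem abs_sepCount_sub_chainSum_le {k : ℕ} {Ω : Type*} (w : ℕ → Ω → Fin k) (n : ℕ) (ω : Ω) :
    |(sepCount w n ω : ℝ) - chainSum (fun _ a => a) (fun x a => if Neighbor x a then 0 else 1)
      (fun i => w i ω) n| ≤ 1 := by
  rcases n with - | n
  · simp [sepCount, randomWord, separationNumber_eq, chainSum]
  · rw [sepCount, randomWord, separationNumber_ofFn (fun i => w i ω), chainSum, chainSum,
      Finset.sum_range_succ]
    split_ifs <;> simp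

theorem abs_leftCount_sub_chainSum_le {k : ℕ} {Ω : Type*} (w : ℕ → Ω → Fin k) (n : ℕ) (ω : Ω) :
    |(leftCount w n ω : ℝ) - chainSum accept (fun x a => if Neighbor x a then 1 else 0)
      (fun i => w i ω) n| ≤ 1 := by
  rcases n with - | n
  · have : {r : ℕ | ∃ l, r = l + 1 ∧ leftPos ([] : List (Fin k)) l < ⊤} = ∅ := by
      refine Set.eq_empty_iff_forall_notMem.2 ?_
      rintro r ⟨l, -, hl⟩
      obtain ⟨j, -⟩ := leftPos_lt_top _ l hl
      exact j.elim0
    simp [leftCount, randomWord, leftLength, this, chainSum]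
  · rw [leftCount, randomWord, leftLength_ofFn (fun i => w i ω), chainSum, chainSum,
      Finset.sum_range_succ]
    rw [abs_le]
    split_ifs <;> constructor <;> linarith

end StaircaseWords

theorem theorem1p2 (k : ℕ) (hk : 3 ≤ k) :
    ∃ σ ν : ℝ, 0 < σ ∧ 0 < ν ∧
      ∀ (Ω : Type*) [MeasurableSpace Ω] (P : Measure Ω) [IsProbabilityMeasure P]
        (w : ℕ → Ω → Fin k), IsUniformLetters P w →
        (∀ᵐ ω ∂P, Tendsto (fun n : ℕ => (sepCount w n ω : ℝ) / n) atTop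
          (𝓝 (((k : ℝ) - 2) * ((k : ℝ) - 1) / (k : ℝ) ^ 2))) ∧
        TendstoInDistribution
          (fun (n : ℕ) ω =>
            ((sepCount w n ω : ℝ) - ((k : ℝ) - 2) * ((k : ℝ) - 1) / (k : ℝ) ^ 2 * n) /
              (σ * √(n : ℝ)))
          atTop (id : ℝ → ℝ) (fun _ => P) (gaussianReal 0 1) ∧
        (∀ᵐ ω ∂P, Tendsto (fun n : ℕ => (leftCount w n ω : ℝ) / n) atTop
          (𝓝 ((3 * (k : ℝ) - 2) / (k : ℝ) ^ 2))) ∧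
        TendstoInDistribution
          (fun (n : ℕ) ω =>
            ((leftCount w n ω : ℝ) - (3 * (k : ℝ) - 2) / (k : ℝ) ^ 2 * n) / (ν * √(n : ℝ)))
          atTop (id : ℝ → ℝ) (fun _ => P) (gaussianReal 0 1) := by
  have hk0 : k ≠ 0 := by omega
  have hkR : (3 : ℝ) ≤ k := by exact_mod_cast hk
  have hkne : (k : ℝ) ≠ 0 := by positivity
  have hnb := sum_sum_neighbor (k := k) (by omega)
  have hsep : ∑ x : Fin k, ∑ a : Fin k, (if Neighbor x a then (0 : ℝ) else 1) =
      (k : ℝ) ^ 2 * (((k : ℝ) - 2) * ((k : ℝ) - 1) / (k : ℝ) ^ 2) := by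
    have : ∀ x a : Fin k, (if Neighbor x a then (0 : ℝ) else 1) =
        1 - if Neighbor x a then 1 else 0 := by
      intro x a
      split_ifs <;> simp
    simp only [this, Finset.sum_sub_distrib, hnb]
    simp
    field_simp
    ring
  have hleft : ∑ x : Fin k, ∑ a : Fin k, (if Neighbor x a then (1 : ℝ) else 0) =
      (k : ℝ) ^ 2 * ((3 * (k : ℝ) - 2) / (k : ℝ) ^ 2) := by
    rw [hnb]
    field_simp
  have hψ : 0 < ((k : ℝ) - 2) * ((k : ℝ) - 1) / (k : ℝ) ^ 2 :=
    div_pos (mul_pos (by linarith) (by linarith)) (by positivity)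
  have hφ : 0 < (3 * (k : ℝ) - 2) / (k : ℝ) ^ 2 := div_pos (by linarith) (by positivity)
  -- Loop: a repeated letter adds no separation, while the mean is positive because `k > 2`.
  obtain ⟨σ, hσ, hS⟩ := exists_limit_laws hk0 poissonSolvable_last hsep
    ⟨⟨0, by omega⟩, ⟨0, by omega⟩, rfl, by
      rw [if_pos (by simp [neighbor_iff])]
      exact hψ.ne⟩ 1
  -- Loop of the other chain: the third letter is rejected by the first, so the chain stays put and
  -- `g = 0` there. Such a pair exists because `k ≥ 3`.
  have hfar : ¬ Neighbor (⟨0, by omega⟩ : Fin k) ⟨2, by omega⟩ := by simp [neighbor_iff]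
  obtain ⟨ν, hν, hJ⟩ := exists_limit_laws hk0 poissonSolvable_accept hleft
    ⟨⟨0, by omega⟩, ⟨2, by omega⟩, if_neg hfar, by
      rw [if_neg hfar]
      exact hφ.ne⟩ 1
  refine ⟨σ, ν, hσ, hν, fun Ω _ P _ w hw => ?_⟩
  obtain ⟨hS1, hS2⟩ := hS Ω P w hw (sepCount w)
    (measurable_comp_randomWord hw.measurable separationNumber) (abs_sepCount_sub_chainSum_le w)
  obtain ⟨hJ1, hJ2⟩ := hJ Ω P w hw (leftCount w)
    (measurable_comp_randomWord hw.measurable leftLength) (abs_leftCount_sub_chainSum_le w)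
  exact ⟨hS1, hS2, hJ1, hJ2⟩
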